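/- Let $(X,d)$ be a metric space. Let $\mathcal P(X)$ be the set of separably supported probability measures on the Borel $\sigma$-algebra of $X$ (i.e. those concentrated on a separable subset), let $$d_W(\mu,\nu)=\inf_K\int_{X\times X} d(x,y)\,\mathrm dK(x,y)\in[0,\infty],$$ where $K$ ranges over the couplings of $\mu,\nu\in\mathcal P(X)$, i.e. the $K\in\mathcal P(X\times X)$ with marginals $\mu$ and $\nu$, and let $\mathcal P_1(X)$ be the set of $\mu\in\mathcal P(X)$ with $d_W(\delta_x,\mu)<\infty$ for some $x\in X$. A contracting barycenter map on $X$ is a map $b:\mathcal P_1(X)\to X$ with $b(\delta_x)=x$ for all $x\in X$ and $d(b(\mu),b(\nu))\le d_W(\mu,\nu)$ for all $\mu,\nu\in\mathcal P_1(X)$. A conical (geodesic) bicombing on $X$ is a map $\sigma:X\times X\times[0,1]\to X$ such that for all $x,y,x',y'\in X$ and $s,t\in[0,1]$: $\sigma(x,y,0)=x$, $\sigma(x,y,1)=y$, $d(\sigma(x,y,s),\sigma(x,y,t))=|s-t|\,d(x,y)$, and $$d(\sigma(x,y,t),\sigma(x',y',t))\le(1-t)\,d(x,x')+t\,d(y,y').$$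 1. If $b$ is a contracting barycenter map on $X$, then $\sigma(x,y,t):=b((1-t)\delta_x+t\delta_y)$ is a conical bicombing on $X$. In particular, if $X$ admits a contracting barycenter map, it admits a conical bicombing. 2. If $X$ is complete and admits a conical bicombing, then $X$ admits a contracting barycenter map. -/

import Mathlib

open MeasureTheory
open scoped ENNReal

noncomputable section

/-- The set `𝒫(Z)` of separably supported probability measures on the Borel `σ`-algebra of `Z`.
The measure is concentrated on a separable set (equivalently, passing to the closure when `Z` is
metrizable, on a closed separable set). The Borel `σ`-algebra is used explicitly,
because on a product `X × X` it can be larger than the product `σ`-algebra. -/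
structure SepProb (Z : Type*) [TopologicalSpace Z] where
  meas : @Measure Z (borel Z)
  prob : IsProbabilityMeasure meas
  sep : ∃ S : Set Z, TopologicalSpace.IsSeparable S ∧ meas Sᶜ = 0

/-- The Dirac measure at `x` on the Borel `σ`-algebra. -/
def borelDirac {Z : Type*} [TopologicalSpace Z] (x : Z) : @Measure Z (borel Z) :=
  @Measure.dirac Z (borel Z) x

/-- The measure `(1 - t) δ_x + t δ_y` as an element of `𝒫(Z)`. -/
def SepProb.mix {Z : Type*} [TopologicalSpace Z] (x y : Z) (t : unitInterval) : SepProb Z where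
  meas := ENNReal.ofReal (1 - (t : ℝ)) • borelDirac x + ENNReal.ofReal (t : ℝ) • borelDirac y
  prob := by
    let : MeasurableSpace Z := borel Z
    refine ⟨?_⟩
    simp only [borelDirac, Measure.add_apply, Measure.smul_apply, Measure.dirac_apply_of_mem,
      Set.mem_univ, smul_eq_mul, mul_one]
    rw [← ENNReal.ofReal_add (sub_nonneg.2 t.2.2) t.2.1]
    simp
  sep := by
    let : MeasurableSpace Z := borel Z
    refine ⟨closure {x, y}, (Set.toFinite {x, y}).countable.isSeparable.closure, ?_⟩
    have hm : MeasurableSet (closure ({x, y} : Set Z))ᶜ :=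
      MeasurableSpace.measurableSet_generateFrom isClosed_closure.isOpen_compl
    have hx : x ∈ closure ({x, y} : Set Z) := subset_closure (by simp)
    have hy : y ∈ closure ({x, y} : Set Z) := subset_closure (by simp)
    simp [borelDirac, Measure.dirac_apply' _ hm, hx, hy]

/-- The Dirac measure `δ_x` as an element of `𝒫(Z)`. -/
def SepProb.dirac {Z : Type*} [TopologicalSpace Z] (x : Z) : SepProb Z where
  meas := borelDirac x
  prob := by
    let : MeasurableSpace Z := borel Z
    exact Measure.dirac.isProbabilityMeasure
  sep := by
    let : MeasurableSpace Z := borel Z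
    refine ⟨closure {x}, (Set.countable_singleton x).isSeparable.closure, ?_⟩
    have hm : MeasurableSet (closure ({x} : Set Z))ᶜ :=
      MeasurableSpace.measurableSet_generateFrom isClosed_closure.isOpen_compl
    have hx : x ∈ closure ({x} : Set Z) := subset_closure (by simp)
    simp [borelDirac, Measure.dirac_apply' _ hm, hx]

/-- `K ∈ 𝒫(X × X)` is a coupling of `μ` and `ν`: its marginals are `μ` and `ν`. -/
def IsCoupling {X : Type*} [TopologicalSpace X] (μ ν : SepProb X) (K : SepProb (X × X)) : Prop :=
  @Measure.map (X × X) X (borel (X × X)) (borel X) Prod.fst K.meas = μ.meas ∧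
  @Measure.map (X × X) X (borel (X × X)) (borel X) Prod.snd K.meas = ν.meas

/-- The Wasserstein `1`-distance on `𝒫(X)`, with values in `[0, ∞]`. -/
def wassersteinDist {X : Type*} [MetricSpace X] (μ ν : SepProb X) : ℝ≥0∞ :=
  ⨅ (K : SepProb (X × X)) (_ : IsCoupling μ ν K), ∫⁻ p, edist p.1 p.2 ∂K.meas

/-- Wasserstein `1`-space `𝒫₁(X)`: the measures in `𝒫(X)` at finite Wasserstein distance from
some Dirac measure. -/
def Wasserstein1 (X : Type*) [MetricSpace X] : Type _ :=
  {μ : SepProb X // ∃ x : X, wassersteinDist (SepProb.dirac x) μ < ∞}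

lemma wassersteinDist_dirac_mix_lt_top {X : Type*} [MetricSpace X] (x y : X) (t : unitInterval) :
    wassersteinDist (SepProb.dirac x) (SepProb.mix x y t) < ∞ := by
  let : MeasurableSpace X := borel X
  have : BorelSpace X := ⟨rfl⟩
  let : MeasurableSpace (X × X) := borel (X × X)
  have : BorelSpace (X × X) := ⟨rfl⟩
  have h1 : Measurable (Prod.fst : X × X → X) := continuous_fst.measurable
  have h2 : Measurable (Prod.snd : X × X → X) := continuous_snd.measurable
  have hd : Measurable fun p : X × X => edist p.1 p.2 := continuous_edist.measurable
  have hK : IsCoupling (SepProb.dirac x) (SepProb.mix x y t) (SepProb.mix (x, x) (x, y) t) := by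
    constructor
    · change Measure.map Prod.fst (_ • Measure.dirac (x, x) + _ • Measure.dirac (x, y)) =
        Measure.dirac x
      rw [Measure.map_add _ _ h1, Measure.map_smul, Measure.map_smul, Measure.map_dirac' h1,
        Measure.map_dirac' h1, ← add_smul, ← ENNReal.ofReal_add (sub_nonneg.2 t.2.2) t.2.1]
      simp
    · change Measure.map Prod.snd (_ • Measure.dirac (x, x) + _ • Measure.dirac (x, y)) =
        _ • Measure.dirac x + _ • Measure.dirac y
      rw [Measure.map_add _ _ h2, Measure.map_smul, Measure.map_smul, Measure.map_dirac' h2,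
        Measure.map_dirac' h2]
  refine (iInf₂_le _ hK).trans_lt ?_
  change ∫⁻ p : X × X, edist p.1 p.2 ∂(ENNReal.ofReal (1 - (t : ℝ)) • Measure.dirac (x, x) +
    ENNReal.ofReal (t : ℝ) • Measure.dirac (x, y)) < ∞
  rw [lintegral_add_measure, lintegral_smul_measure, lintegral_smul_measure,
    lintegral_dirac' _ hd, lintegral_dirac' _ hd]
  simpa using ENNReal.mul_lt_top ENNReal.ofReal_lt_top (edist_lt_top x y)

lemma SepProb.mix_zero {X : Type*} [TopologicalSpace X] (x y : X) :
    SepProb.mix x y 0 = SepProb.dirac x := by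
  simp [SepProb.mix, SepProb.dirac]

/-- The measure `(1 - t) δ_x + t δ_y` as an element of `𝒫₁(X)`. -/
def Wasserstein1.mix {X : Type*} [MetricSpace X] (x y : X) (t : unitInterval) : Wasserstein1 X :=
  ⟨SepProb.mix x y t, x, wassersteinDist_dirac_mix_lt_top x y t⟩

/-- The Dirac measure `δ_x` as an element of `𝒫₁(X)`. -/
def Wasserstein1.dirac {X : Type*} [MetricSpace X] (x : X) : Wasserstein1 X :=
  ⟨SepProb.dirac x, x, by
    simpa [SepProb.mix_zero] using wassersteinDist_dirac_mix_lt_top x x 0⟩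

/-- A contracting barycenter map on `X`: a retraction for `δ : X → 𝒫₁(X)` that is `1`-Lipschitz
for the Wasserstein `1`-distance. -/
structure IsContractingBarycenterMap {X : Type*} [MetricSpace X] (b : Wasserstein1 X → X) :
    Prop where
  map_dirac : ∀ x, b (Wasserstein1.dirac x) = x
  contracting : ∀ μ ν, edist (b μ) (b ν) ≤ wassersteinDist μ.1 ν.1

/-- A conical (geodesic) bicombing on `X`: each `σ x y` is a constant speed shortest path from `x`
to `y` (so that `X` is in particular a geodesic space), and the conical inequality holds. -/
structure IsConicalBicombing {X : Type*} [MetricSpace X] (σ : X → X → unitInterval → X) :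
    Prop where
  map_zero : ∀ x y, σ x y 0 = x
  map_one : ∀ x y, σ x y 1 = y
  geodesic : ∀ x y (s t : unitInterval),
    dist (σ x y s) (σ x y t) = |(s : ℝ) - (t : ℝ)| * dist x y
  conical : ∀ x y x' y' (t : unitInterval),
    dist (σ x y t) (σ x' y' t) ≤ (1 - (t : ℝ)) * dist x x' + (t : ℝ) * dist y y'

end

/-! A contracting barycenter map gives a conical bicombing by explicit couplings. Masses at
corresponding endpoints are paired for the conical inequality. Moving mass `t - s` from `x` to `y`
bounds the distance of two points on one path, and the triangle inequality from `x` to `y` turns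
these bounds into equalities.

For the converse only the midpoint map `m x y` of the bicombing is used. Iterating `{x, y} ↦ {m x y,
m y x}` shrinks a pair to a symmetric mean of two points; iterating "replace each point by the mean
of the others" produces a mean of `n + 1` points from one of `n`
(`IsContractingMultisetMap.exists_mean`). These means are 1-Lipschitz for transport of uniform
measures, but they need not be compatible with repeating points, so they do not directly define a
barycenter of a finitely supported measure.

The barycenter of the law of a simple function is instead the limit of the means of `n` independent
samples, as in a law of large numbers. The means of two independent samples are at expected distance
`O(1/√n)`, by the variance of the empirical counts (`IsMeanFamily.exists_spread_le`). The expected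
distance from the mean to a fixed point decreases in `n`, by exchangeability
(`IsMeanFamily.sampleMean_succ_le`). Together these give a limit point
(`IsMeanFamily.exists_isSampleLimit`). Sampling from a coupling makes it contracting, and
completeness extends it from simple functions to all of `𝒫₁(X)`. -/

/-! ### Symmetric means as limits of contracting multiset maps. -/

/-- `β` restricted to multisets of cardinality `n` is an idempotent mean which is `1`-Lipschitz for
the transport distance between uniform measures. -/
structure IsMultisetMean {X : Type*} [MetricSpace X] (n : ℕ) (β : Multiset X → X) : Prop where
  replicate : ∀ x, β (Multiset.replicate n x) = x
  lipschitz : ∀ p : Multiset (X × X), p.card = n →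
    n * dist (β (p.map Prod.fst)) (β (p.map Prod.snd)) ≤ (p.map fun q => dist q.1 q.2).sum

theorem IsMultisetMean.dist_le {X : Type*} [MetricSpace X] {n : ℕ} {β : Multiset X → X}
    (h : IsMultisetMean n β) {s : Multiset X} (hs : s.card = n) (z : X) :
    n * dist (β s) z ≤ (s.map fun a => dist a z).sum := by
  have := h.lipschitz (s.map fun a => (a, z)) (by simpa using hs)
  simpa [Multiset.map_map, Function.comp_def, hs, h.replicate] using this

theorem Multiset.sum_map_add_const {α : Type*} (p : Multiset α) (f : α → ℝ) (c : ℝ) :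
    (p.map fun q => f q + c).sum = (p.map f).sum + p.card * c := by
  simp [Multiset.sum_map_add]

theorem Multiset.exists_dist_le {X : Type*} [MetricSpace X] (s : Multiset X) :
    ∃ D : ℝ, 0 ≤ D ∧ ∀ x ∈ s, ∀ y ∈ s, dist x y ≤ D := by
  classical
  have hb : Bornology.IsBounded (s.toFinset : Set X) := s.toFinset.finite_toSet.isBounded
  refine ⟨Metric.diam (s.toFinset : Set X), Metric.diam_nonneg, fun x hx y hy => ?_⟩
  exact Metric.dist_le_diam_of_mem hb (by simpa using hx) (by simpa using hy)

/-- A map on multisets of cardinality `n` that halves diameters and is nonexpanding for the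
transport distance. -/
structure IsContractingMultisetMap {X : Type*} [MetricSpace X] (n : ℕ)
    (Φ : Multiset X → Multiset X) : Prop where
  card : ∀ s, s.card = n → (Φ s).card = n
  transport : ∀ p : Multiset (X × X), p.card = n → ∃ p' : Multiset (X × X),
    p'.map Prod.fst = Φ (p.map Prod.fst) ∧ p'.map Prod.snd = Φ (p.map Prod.snd) ∧
    (p'.map fun q => dist q.1 q.2).sum ≤ (p.map fun q => dist q.1 q.2).sum
  diam : ∀ s, s.card = n → ∀ D : ℝ, (∀ x ∈ s, ∀ y ∈ s, dist x y ≤ D) →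
    (∀ x ∈ Φ s, ∀ y ∈ Φ s, dist x y ≤ D / 2) ∧ ∀ x ∈ s, ∀ y ∈ Φ s, dist x y ≤ D

namespace IsContractingMultisetMap

variable {X : Type*} [MetricSpace X] {n : ℕ} {Φ : Multiset X → Multiset X}

theorem card_iterate (h : IsContractingMultisetMap n Φ) {s : Multiset X} (hs : s.card = n)
    (k : ℕ) : (Φ^[k] s).card = n := by
  induction k with
  | zero => simpa using hs
  | succ k ih => rw [Function.iterate_succ_apply']; exact h.card _ ih

theorem diam_iterate (h : IsContractingMultisetMap n Φ) {s : Multiset X} (hs : s.card = n)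
    {D : ℝ} (hD : ∀ x ∈ s, ∀ y ∈ s, dist x y ≤ D) (k : ℕ) :
    ∀ x ∈ Φ^[k] s, ∀ y ∈ Φ^[k] s, dist x y ≤ D / 2 ^ k := by
  induction k with
  | zero => simpa using hD
  | succ k ih =>
    rw [Function.iterate_succ_apply']
    have := (h.diam _ (h.card_iterate hs k) _ ih).1
    intro x hx y hy
    have := this x hx y hy
    rwa [div_div, ← pow_succ] at this

theorem transport_iterate (h : IsContractingMultisetMap n Φ) {p : Multiset (X × X)}
    (hp : p.card = n) (k : ℕ) : ∃ p' : Multiset (X × X),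
    p'.map Prod.fst = Φ^[k] (p.map Prod.fst) ∧ p'.map Prod.snd = Φ^[k] (p.map Prod.snd) ∧
    (p'.map fun q => dist q.1 q.2).sum ≤ (p.map fun q => dist q.1 q.2).sum := by
  induction k with
  | zero => exact ⟨p, by simp⟩
  | succ k ih =>
    obtain ⟨p₁, h1, h2, h3⟩ := ih
    have hc : p₁.card = n := by
      rw [← Multiset.card_map Prod.fst p₁, h1]
      exact h.card_iterate (by simpa using hp) k
    obtain ⟨p₂, g1, g2, g3⟩ := h.transport p₁ hc
    refine ⟨p₂, ?_, ?_, g3.trans h3⟩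
    · rw [Function.iterate_succ_apply', g1, h1]
    · rw [Function.iterate_succ_apply', g2, h2]

theorem exists_limit [CompleteSpace X] (hn : 0 < n) (h : IsContractingMultisetMap n Φ)
    {s : Multiset X} (hs : s.card = n) :
    ∃ y : X, ∃ C : ℝ, ∀ k, ∀ x ∈ Φ^[k] s, dist x y ≤ C / 2 ^ k := by
  obtain ⟨D, hD0, hD⟩ := s.exists_dist_le
  have hne : ∀ k, ∃ x, x ∈ Φ^[k] s := fun k =>
    Multiset.card_pos_iff_exists_mem.1 (by rw [h.card_iterate hs k]; exact hn)
  choose x hx using hne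
  -- The bound is `D / 2 ^ k`, written in the shape `C / 2 / 2 ^ k` with `C = 2 * D` of the
  -- geometric Cauchy criterion.
  have hstep : ∀ k, dist (x k) (x (k + 1)) ≤ 2 * D / 2 / 2 ^ k := by
    intro k
    have := (h.diam _ (h.card_iterate hs k) _ (h.diam_iterate hs hD k)).2 (x k) (hx k)
      (x (k + 1)) (by have := hx (k + 1); rwa [Function.iterate_succ_apply'] at this)
    simpa using this
  obtain ⟨y, hy⟩ := cauchySeq_tendsto_of_complete (cauchySeq_of_le_geometric_two hstep)
  refine ⟨y, D + 2 * D, fun k z hz => ?_⟩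
  have h1 := dist_le_of_le_geometric_two_of_tendsto hstep hy k
  have h2 := h.diam_iterate hs hD k z hz (x k) (hx k)
  calc dist z y ≤ dist z (x k) + dist (x k) y := dist_triangle _ _ _
    _ ≤ D / 2 ^ k + 2 * D / 2 ^ k := add_le_add h2 h1
    _ = _ := by ring

theorem tendsto_bound (C : ℝ) : Filter.Tendsto (fun k : ℕ => C / 2 ^ k) Filter.atTop (nhds 0) := by
  have := (tendsto_pow_atTop_nhds_zero_of_lt_one (r := (1 / 2 : ℝ)) (by norm_num)
    (by norm_num)).const_mul C
  simpa [div_eq_mul_inv] using this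

/-- Transport cost does not grow under iteration, while the two multisets collapse onto `y` and
`y'`; in the limit the cost is that of `n` copies of `(y, y')`. -/
theorem dist_limit_le (h : IsContractingMultisetMap n Φ) {p : Multiset (X × X)}
    (hp : p.card = n) {y y' : X} {C C' : ℝ}
    (hy : ∀ k, ∀ x ∈ Φ^[k] (p.map Prod.fst), dist x y ≤ C / 2 ^ k)
    (hy' : ∀ k, ∀ x ∈ Φ^[k] (p.map Prod.snd), dist x y' ≤ C' / 2 ^ k) :
    n * dist y y' ≤ (p.map fun q => dist q.1 q.2).sum := by
  have key : ∀ k : ℕ, n * dist y y' ≤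
      (p.map fun q => dist q.1 q.2).sum + n * (C / 2 ^ k + C' / 2 ^ k) := by
    intro k
    obtain ⟨p', h1, h2, h3⟩ := h.transport_iterate hp k
    have hc : p'.card = n := by
      rw [← Multiset.card_map Prod.fst p', h1]
      exact h.card_iterate (by simpa using hp) k
    have : (p'.map fun _ => dist y y').sum ≤
        (p'.map fun q => dist q.1 q.2 + (C / 2 ^ k + C' / 2 ^ k)).sum := by
      refine Multiset.sum_map_le_sum_map _ _ fun q hq => ?_
      have a1 := hy k q.1 (by rw [← h1]; exact Multiset.mem_map_of_mem _ hq)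
      have a2 := hy' k q.2 (by rw [← h2]; exact Multiset.mem_map_of_mem _ hq)
      have a3 := dist_triangle4 y q.1 q.2 y'
      rw [dist_comm] at a1
      linarith
    rw [Multiset.sum_map_add_const, hc] at this
    simp only [Multiset.map_const', Multiset.sum_replicate, hc, nsmul_eq_mul] at this
    linarith
  have hlim : Filter.Tendsto (fun k : ℕ => (p.map fun q => dist q.1 q.2).sum +
      n * (C / 2 ^ k + C' / 2 ^ k)) Filter.atTop
      (nhds ((p.map fun q => dist q.1 q.2).sum + n * (0 + 0))) :=
    (((tendsto_bound C).add (tendsto_bound C')).const_mul _).const_add _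
  simpa using ge_of_tendsto' hlim key

theorem exists_mean [CompleteSpace X] [Nonempty X] (hn : 0 < n)
    (h : IsContractingMultisetMap n Φ) :
    ∃ β : Multiset X → X, IsMultisetMean n β ∧ ∀ s, s.card = n → β (Φ s) = β s := by
  have : ∀ s : Multiset X, ∃ y : X, s.card = n →
      ∃ C : ℝ, ∀ k, ∀ x ∈ Φ^[k] s, dist x y ≤ C / 2 ^ k := by
    intro s
    by_cases hs : s.card = n
    · obtain ⟨y, hy⟩ := h.exists_limit hn hs
      exact ⟨y, fun _ => hy⟩
    · exact ⟨Classical.arbitrary X, fun h => absurd h hs⟩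
  choose β hβ using this
  have hlip : ∀ p : Multiset (X × X), p.card = n →
      n * dist (β (p.map Prod.fst)) (β (p.map Prod.snd)) ≤ (p.map fun q => dist q.1 q.2).sum := by
    intro p hp
    obtain ⟨C, hC⟩ := hβ (p.map Prod.fst) (by simpa using hp)
    obtain ⟨C', hC'⟩ := hβ (p.map Prod.snd) (by simpa using hp)
    exact h.dist_limit_le hp hC hC'
  -- The diagonal coupling has cost zero, so an orbit has only one limit with geometric rate. Both
  -- idempotence and invariance under `Φ` follow from this.
  have huniq : ∀ s : Multiset X, s.card = n → ∀ z : X, ∀ C : ℝ,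
      (∀ k, ∀ x ∈ Φ^[k] s, dist x z ≤ C / 2 ^ k) → β s = z := by
    intro s hs z C hz
    obtain ⟨C', hC'⟩ := hβ s hs
    have := h.dist_limit_le (p := s.map fun a => (a, a)) (by simpa using hs) (y := β s) (y' := z)
      (C := C') (C' := C) (by simpa [Multiset.map_map] using hC')
      (by simpa [Multiset.map_map] using hz)
    simp only [Multiset.map_map, Function.comp_def, dist_self, Multiset.map_const',
      Multiset.sum_replicate, smul_zero] at this
    have hn' : (0 : ℝ) < n := by exact_mod_cast hn
    exact dist_le_zero.1 (nonpos_of_mul_nonpos_right this hn')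
  refine ⟨β, ⟨fun x => ?_, hlip⟩, fun s hs => ?_⟩
  · have hfix : Φ (Multiset.replicate n x) = Multiset.replicate n x := by
      have h1 := (h.diam (Multiset.replicate n x) (by simp) 0 (by
        intro a ha b hb
        rw [Multiset.eq_of_mem_replicate ha, Multiset.eq_of_mem_replicate hb, dist_self])).2 x
        (Multiset.mem_replicate.2 ⟨hn.ne', rfl⟩)
      refine Multiset.eq_replicate.2 ⟨h.card _ (by simp), fun b hb => ?_⟩
      exact (dist_le_zero.1 (h1 b hb)).symm
    refine huniq _ (by simp) x 0 fun k y hy => ?_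
    rw [Function.iterate_fixed hfix] at hy
    simp [Multiset.eq_of_mem_replicate hy]
  · obtain ⟨C, hC⟩ := hβ s hs
    refine huniq _ (h.card s hs) _ (C / 2) fun k x hx => ?_
    have := hC (k + 1) x (by simpa using hx)
    rwa [pow_succ', ← div_div] at this

end IsContractingMultisetMap

/-! ### Inductive construction of the means of `n` points. -/

section Step

variable {X : Type*} [MetricSpace X] {n : ℕ} {β : Multiset X → X}

open scoped Classical in
/-- Replace every element of a multiset by the mean of the other elements. -/
noncomputable def Multiset.leaveOneOut (β : Multiset X → X) (s : Multiset X) : Multiset X :=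
  s.map fun a => β (s.erase a)

-- If `S` is the total cost, leaving out the pair `q` costs at most `(S - dist q.1 q.2) / n`; summed
-- over the `n + 1` pairs this is `S`. Two leave-one-out multisets differ in one point, so their
-- means are within `D / n`. This is at most `D / 2` as `n ≥ 2`; for `n = 1` the map only swaps the
-- two points, so pairs need the midpoint map.
open scoped Classical in
theorem IsMultisetMean.isContracting_leaveOneOut (h : IsMultisetMean n β) (hn : 2 ≤ n) :
    IsContractingMultisetMap (n + 1) (Multiset.leaveOneOut β) := by
  have hn0 : (0 : ℝ) < n := by exact_mod_cast (by omega : 0 < n)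
  have hn2 : (2 : ℝ) ≤ n := by exact_mod_cast hn
  refine ⟨fun s hs => by simpa [Multiset.leaveOneOut] using hs, fun p hp => ?_, fun s hs D hD => ?_⟩
  · refine ⟨p.map fun q => (β ((p.erase q).map Prod.fst), β ((p.erase q).map Prod.snd)),
      ?_, ?_, ?_⟩
    · simp only [Multiset.leaveOneOut, Multiset.map_map, Function.comp_def]
      exact Multiset.map_congr rfl fun q hq => by rw [Multiset.map_erase_of_mem _ _ hq]
    · simp only [Multiset.leaveOneOut, Multiset.map_map, Function.comp_def]
      exact Multiset.map_congr rfl fun q hq => by rw [Multiset.map_erase_of_mem _ _ hq]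
    · set S := (p.map fun q => dist q.1 q.2).sum with hS
      have h1 : ∀ q ∈ p, dist (β ((p.erase q).map Prod.fst)) (β ((p.erase q).map Prod.snd)) ≤
          (n : ℝ)⁻¹ * -dist q.1 q.2 + (n : ℝ)⁻¹ * S := by
        intro q hq
        have hc : (p.erase q).card = n := by rw [Multiset.card_erase_of_mem hq, hp]; rfl
        have h2 := h.lipschitz _ hc
        have h3 : S = dist q.1 q.2 + ((p.erase q).map fun q => dist q.1 q.2).sum := by
          rw [hS, ← Multiset.sum_cons, ← Multiset.map_cons (fun q : X × X => dist q.1 q.2),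
            Multiset.cons_erase hq]
        rw [← mul_add, ← div_eq_inv_mul, le_div_iff₀ hn0]
        linarith
      rw [Multiset.map_map]
      refine (Multiset.sum_map_le_sum_map _ _ h1).trans ?_
      rw [Multiset.sum_map_add_const, Multiset.sum_map_mul_left, Multiset.sum_map_neg, ← hS, hp]
      apply le_of_eq
      push_cast
      field_simp
      ring
  · have hD' : ∀ x ∈ s, 0 ≤ D := fun x hx => by simpa using hD x hx x hx
    constructor
    · intro x hx y hy
      obtain ⟨a, ha, rfl⟩ := Multiset.mem_map.1 hx
      obtain ⟨b, hb, rfl⟩ := Multiset.mem_map.1 hy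
      by_cases hab : a = b
      · subst hab
        simpa using div_nonneg (hD' a ha) two_pos.le
      obtain ⟨t, rfl⟩ := Multiset.exists_cons_of_mem ha
      have hb' : b ∈ t := (Multiset.mem_cons.1 hb).resolve_left (Ne.symm hab)
      obtain ⟨u, rfl⟩ := Multiset.exists_cons_of_mem hb'
      have h1 := h.lipschitz ((b, a) ::ₘ u.map fun c => (c, c)) (by simpa using hs)
      have h2 : (a ::ₘ b ::ₘ u).erase b = a ::ₘ u := by
        rw [Multiset.cons_swap, Multiset.erase_cons_head]
      rw [Multiset.erase_cons_head, h2]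
      simp only [Multiset.map_cons, Multiset.map_map, Function.comp_def, Multiset.map_id',
        dist_self, Multiset.map_const', Multiset.sum_cons, Multiset.sum_replicate, smul_zero,
        add_zero] at h1
      have h3 := hD b hb a ha
      have h4 : 2 * dist (β (b ::ₘ u)) (β (a ::ₘ u)) ≤ n * dist (β (b ::ₘ u)) (β (a ::ₘ u)) :=
        mul_le_mul_of_nonneg_right hn2 dist_nonneg
      linarith
    · intro x hx y hy
      obtain ⟨a, ha, rfl⟩ := Multiset.mem_map.1 hy
      have hc : (s.erase a).card = n := by rw [Multiset.card_erase_of_mem ha, hs]; rfl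
      have h1 := h.dist_le hc x
      have h2 : ((s.erase a).map fun b => dist b x).sum ≤ ((s.erase a).map fun _ => D).sum :=
        Multiset.sum_map_le_sum_map _ _ fun b hb => hD b (Multiset.mem_of_mem_erase hb) x hx
      simp only [Multiset.map_const', Multiset.sum_replicate, hc, nsmul_eq_mul] at h2
      rw [dist_comm]
      exact le_of_mul_le_mul_left (h1.trans h2) hn0

open scoped Classical in
/-- The means `β` and `β'` of `n` and `n + 1` points satisfy the monotonicity needed for reverse
martingale arguments. -/
def IsNextMean (n : ℕ) (β β' : Multiset X → X) : Prop :=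
  IsMultisetMean (n + 1) β' ∧ ∀ s : Multiset X, s.card = n + 1 → ∀ z,
    (n + 1) * dist (β' s) z ≤ (s.map fun a => dist (β (s.erase a)) z).sum

/-- Since `β'` is unchanged by the leave-one-out map, its Lipschitz bound can be applied to the
multiset of leave-one-out means. -/
theorem IsMultisetMean.exists_next [CompleteSpace X] [Nonempty X] (h : IsMultisetMean n β)
    (hn : 2 ≤ n) : ∃ β', IsNextMean n β β' := by
  classical
  have hc := h.isContracting_leaveOneOut hn
  obtain ⟨β', hβ', hΦ⟩ := hc.exists_mean n.succ_pos
  refine ⟨β', hβ', fun s hs z => ?_⟩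
  have := hβ'.dist_le (hc.card s hs) z
  rw [hΦ s hs] at this
  simpa [Multiset.leaveOneOut, Multiset.map_map] using this

/-- An idempotent binary map satisfying the conical inequality for midpoints. -/
structure IsMidpointMap (m : X → X → X) : Prop where
  self : ∀ x, m x x = x
  conical : ∀ x y x' y', 2 * dist (m x y) (m x' y') ≤ dist x x' + dist y y'

theorem IsMidpointMap.exists_mean_two [CompleteSpace X] [Nonempty X] {m : X → X → X}
    (hm : IsMidpointMap m) : ∃ β : Multiset X → X, IsMultisetMean 2 β := by
  have : ∀ s : Multiset X, ∃ t : Multiset X, s.card = 2 →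
      ∃ x y, s = {x, y} ∧ t = {m x y, m y x} := by
    intro s
    by_cases hs : s.card = 2
    · obtain ⟨x, y, rfl⟩ := Multiset.card_eq_two.1 hs
      exact ⟨{m x y, m y x}, fun _ => ⟨x, y, rfl, rfl⟩⟩
    · exact ⟨0, fun h => absurd h hs⟩
  choose Φ hΦ using this
  have hpair : ∀ x y, Φ {x, y} = {m x y, m y x} := by
    intro x y
    obtain ⟨x', y', h1, h2⟩ := hΦ {x, y} (by simp)
    rw [h2]
    have h1' : x ::ₘ {y} = x' ::ₘ {y'} := h1
    rcases Multiset.cons_eq_cons.1 h1' with ⟨rfl, h⟩ | ⟨-, t, h3, h4⟩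
    · rw [Multiset.singleton_inj] at h
      rw [h]
    · obtain ⟨rfl, rfl⟩ : y = x' ∧ t = 0 := by
        have := congrArg Multiset.card h3
        simp only [Multiset.card_singleton, Multiset.card_cons] at this
        have ht : t = 0 := Multiset.card_eq_zero.1 (by omega)
        subst ht
        exact ⟨Multiset.singleton_inj.1 h3, rfl⟩
      obtain rfl : y' = x := Multiset.singleton_inj.1 h4
      exact Multiset.pair_comm _ _
  have hc : IsContractingMultisetMap 2 Φ := by
    refine ⟨fun s hs => ?_, fun p hp => ?_, fun s hs D hD => ?_⟩
    · obtain ⟨x, y, rfl⟩ := Multiset.card_eq_two.1 hs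
      rw [hpair]; simp
    · obtain ⟨q, r, rfl⟩ := Multiset.card_eq_two.1 hp
      refine ⟨{(m q.1 r.1, m q.2 r.2), (m r.1 q.1, m r.2 q.2)}, ?_, ?_, ?_⟩
      · exact (hpair _ _).symm
      · exact (hpair _ _).symm
      · have h1 := hm.conical q.1 r.1 q.2 r.2
        have h2 := hm.conical r.1 q.1 r.2 q.2
        simp
        linarith
    · obtain ⟨x, y, rfl⟩ := Multiset.card_eq_two.1 hs
      have hxy := hD x (by simp) y (by simp)
      have e1 := hm.conical x y x x
      have e2 := hm.conical x y y y
      have e3 := hm.conical y x x x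
      have e4 := hm.conical y x y y
      -- With `c = m y x = m c c`, this bounds `2 * dist (m x y) c` by `dist x c + dist y c ≤ dist x
      -- y`, which is the halving of the diameter.
      have e5 := hm.conical x y (m y x) (m y x)
      rw [hm.self] at e1 e2 e3 e4 e5
      rw [dist_self] at e1 e2 e3 e4
      have hyx := dist_comm x y
      have c1 := dist_comm x (m y x)
      have c2 := dist_comm y (m y x)
      have c3 := dist_comm (m x y) (m y x)
      have c4 := dist_comm x (m x y)
      have c5 := dist_comm y (m x y)
      have hnn := dist_nonneg (x := x) (y := y)
      rw [hpair]
      simp only [Multiset.insert_eq_cons, Multiset.mem_cons, Multiset.mem_singleton,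
        forall_eq_or_imp, forall_eq, dist_self]
      refine ⟨⟨⟨?_, ?_⟩, ?_, ?_⟩, ⟨?_, ?_⟩, ?_, ?_⟩ <;> linarith
  obtain ⟨β, hβ, -⟩ := hc.exists_mean two_pos
  exact ⟨β, hβ⟩

theorem IsMultisetMean.apply_singleton (h : IsMultisetMean 1 β) (x : X) : β {x} = x := h.replicate x

theorem IsMidpointMap.exists_next_one [CompleteSpace X] [Nonempty X] {m : X → X → X}
    (hm : IsMidpointMap m) (h : IsMultisetMean 1 β) : ∃ β', IsNextMean 1 β β' := by
  classical
  obtain ⟨β', hβ'⟩ := hm.exists_mean_two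
  refine ⟨β', hβ', fun s hs z => ?_⟩
  obtain ⟨x, y, rfl⟩ := Multiset.card_eq_two.1 hs
  have h1 := hβ'.dist_le (s := {x, y}) (by simp) z
  have e1 : ({x, y} : Multiset X).erase x = {y} := Multiset.erase_cons_head _ _
  have e2 : ({x, y} : Multiset X).erase y = {x} := by
    rw [Multiset.pair_comm]; exact Multiset.erase_cons_head _ _
  simp only [Multiset.insert_eq_cons, Multiset.map_cons, Multiset.map_singleton,
    Multiset.sum_cons, Multiset.sum_singleton] at h1 ⊢
  simp only [← Multiset.insert_eq_cons] at h1 ⊢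
  rw [e1, e2, h.apply_singleton, h.apply_singleton]
  push_cast at h1 ⊢
  linarith

/-- A coherent family of symmetric means on multisets. -/
structure IsMeanFamily (β : ℕ → Multiset X → X) : Prop where
  mean : ∀ n, 0 < n → IsMultisetMean n (β n)
  next : ∀ n, 0 < n → IsNextMean n (β n) (β (n + 1))

theorem IsMidpointMap.exists_meanFamily [CompleteSpace X] [Nonempty X] {m : X → X → X}
    (hm : IsMidpointMap m) : ∃ β : ℕ → Multiset X → X, IsMeanFamily β := by
  classical
  have h1 : ∃ β : Multiset X → X, IsMultisetMean 1 β := by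
    have : ∀ s : Multiset X, ∃ y, ∀ x, s = {x} → y = x := by
      intro s
      by_cases hs : ∃ x, s = {x}
      · obtain ⟨x, rfl⟩ := hs
        exact ⟨x, fun y hy => Multiset.singleton_inj.1 hy⟩
      · exact ⟨Classical.arbitrary X, fun x hx => absurd ⟨x, hx⟩ hs⟩
    choose β hβ using this
    refine ⟨β, fun x => hβ _ x (Multiset.replicate_one x), fun p hp => ?_⟩
    obtain ⟨q, rfl⟩ := Multiset.card_eq_one.1 hp
    rw [hβ _ q.1 (Multiset.map_singleton _ _), hβ _ q.2 (Multiset.map_singleton _ _)]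
    simp
  obtain ⟨β₁, hβ₁⟩ := h1
  have hnext : ∀ n (β : Multiset X → X), ∃ β', IsMultisetMean (n + 1) β →
      IsNextMean (n + 1) β β' := by
    intro n β
    by_cases h : IsMultisetMean (n + 1) β
    · rcases n with _ | n
      · obtain ⟨β', h'⟩ := hm.exists_next_one h
        exact ⟨β', fun _ => h'⟩
      · obtain ⟨β', h'⟩ := h.exists_next (by omega)
        exact ⟨β', fun _ => h'⟩
    · exact ⟨β, fun h' => absurd h' h⟩
  choose next hnext using hnext
  let B : ℕ → Multiset X → X := fun n => Nat.rec β₁ (fun k b => next k b) n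
  have hB : ∀ n, IsMultisetMean (n + 1) (B n) := by
    intro n
    induction n with
    | zero => exact hβ₁
    | succ k ih => exact (hnext k _ ih).1
  -- `B n` is a mean of `n + 1` points; the value at index `0` is irrelevant.
  refine ⟨fun n => B (n - 1), fun n hn => ?_, fun n hn => ?_⟩
  · obtain ⟨k, rfl⟩ := Nat.exists_eq_succ_of_ne_zero hn.ne'
    exact hB k
  · obtain ⟨k, rfl⟩ := Nat.exists_eq_succ_of_ne_zero hn.ne'
    exact hnext k _ (hB k)

end Step

/-! ### Expectations over independent samples of a simple function. -/

section Sampling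

variable {Ω Y Z : Type*} [MeasurableSpace Ω] (P : Measure Ω)

/-- The expectation of `F` after adding to the multiset an independent sample of `f`. -/
noncomputable def sampleStep (f : SimpleFunc Ω Y) (F : Multiset Y → ℝ) (s : Multiset Y) : ℝ :=
  ∫ ω, F (f ω ::ₘ s) ∂P

/-- The expectation of `F` evaluated at `n` independent samples of `f`. -/
noncomputable def sampleMean (f : SimpleFunc Ω Y) (n : ℕ) (F : Multiset Y → ℝ) : ℝ :=
  (sampleStep P f)^[n] F 0

theorem SimpleFunc.integrable_comp [IsFiniteMeasure P] (f : SimpleFunc Ω Y) (G : Y → ℝ) :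
    Integrable (fun ω => G (f ω)) P :=
  SimpleFunc.integrable_of_isFiniteMeasure (f.map G)

variable [IsProbabilityMeasure P] (f : SimpleFunc Ω Y)

theorem sampleStep_add (F G : Multiset Y → ℝ) :
    sampleStep P f (fun s => F s + G s) = fun s => sampleStep P f F s + sampleStep P f G s := by
  ext s
  exact integral_add (SimpleFunc.integrable_comp P f fun y => F (y ::ₘ s))
    (SimpleFunc.integrable_comp P f fun y => G (y ::ₘ s))

omit [IsProbabilityMeasure P] in
theorem sampleStep_const_mul (c : ℝ) (F : Multiset Y → ℝ) :
    sampleStep P f (fun s => c * F s) = fun s => c * sampleStep P f F s := by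
  ext s
  exact integral_const_mul _ _

theorem iterate_sampleStep_add (n : ℕ) (F G : Multiset Y → ℝ) :
    (sampleStep P f)^[n] (fun s => F s + G s) =
      fun s => (sampleStep P f)^[n] F s + (sampleStep P f)^[n] G s := by
  induction n generalizing F G with
  | zero => rfl
  | succ n ih =>
    simp only [Function.iterate_succ_apply]
    rw [sampleStep_add, ih]

omit [IsProbabilityMeasure P] in
theorem iterate_sampleStep_const_mul (n : ℕ) (c : ℝ) (F : Multiset Y → ℝ) :
    (sampleStep P f)^[n] (fun s => c * F s) = fun s => c * (sampleStep P f)^[n] F s := by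
  induction n generalizing F with
  | zero => rfl
  | succ n ih =>
    simp only [Function.iterate_succ_apply]
    rw [sampleStep_const_mul, ih]

theorem iterate_sampleStep_mono (n k : ℕ) {F G : Multiset Y → ℝ}
    (h : ∀ s : Multiset Y, s.card = n + k → (∀ a ∈ s, a ∈ Set.range f) → F s ≤ G s)
    {s : Multiset Y} (hs : s.card = k) (hsf : ∀ a ∈ s, a ∈ Set.range f) :
    (sampleStep P f)^[n] F s ≤ (sampleStep P f)^[n] G s := by
  induction n generalizing k s with
  | zero => exact h s (by simpa using hs) hsf
  | succ n ih =>
    simp only [Function.iterate_succ_apply']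
    refine integral_mono
      (SimpleFunc.integrable_comp P f fun y => (sampleStep P f)^[n] F (y ::ₘ s))
      (SimpleFunc.integrable_comp P f fun y => (sampleStep P f)^[n] G (y ::ₘ s)) fun ω => ?_
    refine ih (k + 1) (fun t ht => h t (by omega)) (by simpa using hs) ?_
    intro a ha
    rcases Multiset.mem_cons.1 ha with rfl | ha
    exacts [Set.mem_range_self ω, hsf a ha]

theorem sampleMean_mono (n : ℕ) {F G : Multiset Y → ℝ}
    (h : ∀ s : Multiset Y, s.card = n → (∀ a ∈ s, a ∈ Set.range f) → F s ≤ G s) :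
    sampleMean P f n F ≤ sampleMean P f n G :=
  iterate_sampleStep_mono P f n 0 (by simpa using h) rfl (by simp)

theorem sampleMean_add (n : ℕ) (F G : Multiset Y → ℝ) :
    sampleMean P f n (fun s => F s + G s) = sampleMean P f n F + sampleMean P f n G :=
  congrFun (iterate_sampleStep_add P f n F G) 0

omit [IsProbabilityMeasure P] in
theorem sampleMean_const_mul (n : ℕ) (c : ℝ) (F : Multiset Y → ℝ) :
    sampleMean P f n (fun s => c * F s) = c * sampleMean P f n F :=
  congrFun (iterate_sampleStep_const_mul P f n c F) 0

theorem sampleMean_const (n : ℕ) (c : ℝ) : sampleMean P f n (fun _ => c) = c := by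
  have : ∀ s, (sampleStep P f)^[n] (fun _ => c) s = c := by
    induction n with
    | zero => simp
    | succ n ih =>
      intro s
      simp only [Function.iterate_succ_apply', sampleStep, ih]
      simp
  exact this 0

theorem sampleMean_sum {ι : Type*} (n : ℕ) (t : Finset ι) (F : ι → Multiset Y → ℝ) :
    sampleMean P f n (fun s => ∑ i ∈ t, F i s) = ∑ i ∈ t, sampleMean P f n (F i) := by
  classical
  induction t using Finset.induction_on with
  | empty => simpa using sampleMean_const P f n 0
  | insert i t hi ih => simp only [Finset.sum_insert hi, sampleMean_add, ih]

omit [IsProbabilityMeasure P] in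
theorem sampleMean_map (g : Y → Z) (n : ℕ) (F : Multiset Z → ℝ) :
    sampleMean P f n (fun s => F (s.map g)) = sampleMean P (f.map g) n F := by
  have : ∀ s : Multiset Y, (sampleStep P f)^[n] (fun s => F (s.map g)) s =
      (sampleStep P (f.map g))^[n] F (s.map g) := by
    induction n with
    | zero => simp
    | succ n ih =>
      intro s
      simp only [Function.iterate_succ_apply', sampleStep, ih]
      simp
  exact this 0

omit [IsProbabilityMeasure P] in
theorem sampleMean_comp {Ω' : Type*} [MeasurableSpace Ω'] (Q : Measure Ω')
    {T : Ω' → Ω} (hT : Measurable T) (hQ : Q.map T = P) (n : ℕ) (F : Multiset Y → ℝ) :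
    sampleMean Q (f.comp T hT) n F = sampleMean P f n F := by
  have : ∀ s : Multiset Y, (sampleStep Q (f.comp T hT))^[n] F s =
      (sampleStep P f)^[n] F s := by
    induction n with
    | zero => simp
    | succ n ih =>
      intro s
      simp only [Function.iterate_succ_apply', sampleStep, ih]
      rw [← hQ]
      exact (integral_map hT.aemeasurable
        (f.map fun y => (sampleStep (Q.map T) f)^[n] F (y ::ₘ s)).aestronglyMeasurable).symm
  exact this 0

/-- The sample points are picked one at a time, each keeping the conditional expectation of `F` at
most its mean. -/
theorem exists_le_sampleMean (n : ℕ) (F : Multiset Y → ℝ) :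
    ∃ s : Multiset Y, s.card = n ∧ F s ≤ sampleMean P f n F := by
  have key : ∀ k, ∃ s : Multiset Y, s.card = k ∧
      ∀ m, m + k = n → (sampleStep P f)^[m] F s ≤ sampleMean P f n F := by
    intro k
    induction k with
    | zero => exact ⟨0, rfl, fun m hm => by rw [← hm]; exact le_rfl⟩
    | succ k ih =>
      obtain ⟨s, hs, hsm⟩ := ih
      by_cases hk : k + 1 ≤ n
      · obtain ⟨m, rfl⟩ := Nat.exists_eq_add_of_le' hk
        have h1 := hsm (m + 1) (by omega)
        rw [Function.iterate_succ_apply'] at h1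
        obtain ⟨ω, hω⟩ := exists_le_integral (μ := P)
          (SimpleFunc.integrable_comp P f fun y => (sampleStep P f)^[m] F (y ::ₘ s))
        refine ⟨f ω ::ₘ s, by simpa using hs, fun m' hm' => ?_⟩
        obtain rfl : m' = m := by omega
        exact hω.trans h1
      · have : Nonempty Ω := nonempty_of_isProbabilityMeasure P
        obtain ⟨ω⟩ := this
        exact ⟨Multiset.replicate (k + 1) (f ω), by simp, fun m hm => by omega⟩
  obtain ⟨s, hs, hsm⟩ := key n
  exact ⟨s, hs, hsm 0 (by omega)⟩

open scoped Classical in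
/-- The sum of `G` over all multisets obtained by removing one element. -/
noncomputable def removalSum (G : Multiset Y → ℝ) (s : Multiset Y) : ℝ :=
  (s.map fun a => G (s.erase a)).sum

/-- Removing the new point gives back `s`; removing an old one commutes with adding the sample. -/
theorem sampleStep_removalSum (G : Multiset Y → ℝ) :
    sampleStep P f (removalSum G) = fun s => G s + removalSum (sampleStep P f G) s := by
  classical
  ext s
  have h1 : ∀ ω, removalSum G (f ω ::ₘ s) =
      G s + (s.map fun a => G (f ω ::ₘ s.erase a)).sum := by
    intro ω
    simp only [removalSum, Multiset.map_cons, Multiset.sum_cons, Multiset.erase_cons_head]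
    congr 2
    refine Multiset.map_congr rfl fun a ha => ?_
    by_cases h : f ω = a
    · rw [← h, Multiset.erase_cons_head, Multiset.cons_erase (h ▸ ha)]
    · rw [Multiset.erase_cons_tail _ h]
  have h2 : ∀ t : Multiset Y, ∫ ω, (t.map fun a => G (f ω ::ₘ s.erase a)).sum ∂P =
      (t.map fun a => ∫ ω, G (f ω ::ₘ s.erase a) ∂P).sum := by
    intro t
    induction t using Multiset.induction_on with
    | empty => simp
    | cons a t ih =>
      simp only [Multiset.map_cons, Multiset.sum_cons]
      rw [integral_add (SimpleFunc.integrable_comp P f fun y => G (y ::ₘ s.erase a))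
        (SimpleFunc.integrable_comp P f fun y => (t.map fun a => G (y ::ₘ s.erase a)).sum), ih]
  simp only [sampleStep, h1]
  rw [integral_add (integrable_const _)
    (SimpleFunc.integrable_comp P f fun y => (s.map fun a => G (y ::ₘ s.erase a)).sum), h2]
  simp [removalSum, sampleStep]

/-- Exchangeability: each of the `n + 1` removals leaves `n` independent samples. The induction
needs a general starting multiset; the extra term vanishes at `0`. -/
theorem sampleMean_removalSum (n : ℕ) (G : Multiset Y → ℝ) :
    sampleMean P f (n + 1) (removalSum G) = (n + 1) * sampleMean P f n G := by
  have : ∀ s, (sampleStep P f)^[n + 1] (removalSum G) s =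
      (n + 1) * (sampleStep P f)^[n] G s + removalSum ((sampleStep P f)^[n + 1] G) s := by
    induction n generalizing G with
    | zero =>
      intro s
      simp [sampleStep_removalSum]
    | succ n ih =>
      intro s
      rw [Function.iterate_succ_apply, sampleStep_removalSum, iterate_sampleStep_add]
      simp only [ih]
      rw [← Function.iterate_succ_apply, ← Function.iterate_succ_apply]
      push_cast
      ring
  have h := this 0
  simpa [removalSum, sampleMean] using h

theorem sampleMean_sum_map (n : ℕ) (φ : Y → ℝ) :
    sampleMean P f n (fun s => (s.map φ).sum) = n * ∫ ω, φ (f ω) ∂P := by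
  have : ∀ s, (sampleStep P f)^[n] (fun s => (s.map φ).sum) s =
      (s.map φ).sum + n * ∫ ω, φ (f ω) ∂P := by
    induction n with
    | zero => simp
    | succ n ih =>
      intro s
      simp only [Function.iterate_succ_apply', sampleStep, ih, Multiset.map_cons,
        Multiset.sum_cons]
      simp only [add_assoc]
      rw [integral_add (SimpleFunc.integrable_comp P f φ) (integrable_const _)]
      simp
      ring
  simpa [sampleMean] using this 0

open scoped Classical in
theorem sampleMean_sq_count_le (n : ℕ) (a : Y) :
    sampleMean P f n
      (fun s => ((s.count a : ℝ) - s.card * ∫ ω, (if f ω = a then 1 else 0 : ℝ) ∂P) ^ 2) ≤ n := by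
  set p := ∫ ω, (if f ω = a then 1 else 0 : ℝ) ∂P with hp
  have hint : Integrable (fun ω => (if f ω = a then 1 else 0 : ℝ)) P :=
    SimpleFunc.integrable_comp P f fun y => if y = a then 1 else 0
  have hp0 : 0 ≤ p := integral_nonneg fun ω => by dsimp only; split_ifs <;> simp
  have hp1 : p ≤ 1 := by
    have := integral_mono hint (integrable_const (μ := P) (1 : ℝ)) fun ω => by
      dsimp only; split_ifs <;> simp
    simpa using this
  -- Centring at `s.card * p` makes the count a random walk with mean-zero increments, so each
  -- sample adds exactly the variance `p * (1 - p)`; `c` collects these contributions.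
  have hstep : ∀ c : ℝ, ∀ s : Multiset Y,
      sampleStep P f (fun s => ((s.count a : ℝ) - s.card * p) ^ 2 + c) s =
        ((s.count a : ℝ) - s.card * p) ^ 2 + (c + p * (1 - p)) := by
    intro c s
    set u := (s.count a : ℝ) - s.card * p with hu
    have h1 : ∀ ω, (((f ω ::ₘ s).count a : ℝ) - ((f ω ::ₘ s).card : ℝ) * p) ^ 2 + c =
        (2 * u + 1 - 2 * p) * (if f ω = a then 1 else 0) + (u ^ 2 - 2 * u * p + p ^ 2 + c) := by
      intro ω
      rw [Multiset.count_cons, Multiset.card_cons]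
      by_cases h : f ω = a
      · rw [if_pos h, if_pos h.symm]; push_cast; rw [hu]; ring
      · rw [if_neg h, if_neg (Ne.symm h)]; push_cast; rw [hu]; ring
    simp only [sampleStep, h1]
    rw [integral_add (hint.const_mul _) (integrable_const _), integral_const_mul, ← hp]
    simp
    ring
  have key : ∀ s : Multiset Y,
      (sampleStep P f)^[n] (fun s => ((s.count a : ℝ) - s.card * p) ^ 2) s =
        ((s.count a : ℝ) - s.card * p) ^ 2 + n * (p * (1 - p)) := by
    induction n with
    | zero => simp
    | succ n ih =>
      intro s
      rw [Function.iterate_succ_apply', funext ih, hstep]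
      push_cast
      ring
  have h := key 0
  simp only [Multiset.count_zero, Multiset.card_zero] at h
  change (sampleStep P f)^[n] _ 0 ≤ n
  rw [h]
  have : p * (1 - p) ≤ 1 := by nlinarith
  have hn : (0 : ℝ) ≤ n := n.cast_nonneg
  norm_num
  nlinarith

-- Follows from the variance bound and `t ≤ t ^ 2 / √n + √n`, which replaces the Cauchy–Schwarz
-- inequality.
open scoped Classical in
theorem sampleMean_abs_count_le {n : ℕ} (hn : 0 < n) (a : Y) :
    sampleMean P f n
      (fun s => |(s.count a : ℝ) - n * ∫ ω, (if f ω = a then 1 else 0 : ℝ) ∂P|) ≤ 2 * √n := by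
  set p := ∫ ω, (if f ω = a then 1 else 0 : ℝ) ∂P
  have hs : 0 < √(n : ℝ) := Real.sqrt_pos.2 (by exact_mod_cast hn)
  have hs2 : √(n : ℝ) * √n = n := Real.mul_self_sqrt n.cast_nonneg
  have h1 : sampleMean P f n (fun s => |(s.count a : ℝ) - n * p|) ≤ sampleMean P f n
      (fun s => (√n)⁻¹ * ((s.count a : ℝ) - s.card * p) ^ 2 + √n) := by
    refine sampleMean_mono P f n fun s hs' _ => ?_
    rw [hs', ← sq_abs]
    set t := |(s.count a : ℝ) - n * p|
    rw [← sub_nonneg]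
    have : (√n)⁻¹ * t ^ 2 + √n - t = (√(n : ℝ))⁻¹ * (t ^ 2 + √n * √n - √n * t) := by
      field_simp
    rw [this]
    refine mul_nonneg (inv_nonneg.2 hs.le) ?_
    nlinarith [sq_nonneg (t - √n), sq_nonneg t, sq_nonneg (√(n : ℝ))]
  rw [sampleMean_add, sampleMean_const_mul, sampleMean_const] at h1
  have h2 := sampleMean_sq_count_le P f n a
  have h3 : (√(n : ℝ))⁻¹ * sampleMean P f n (fun s => ((s.count a : ℝ) - s.card * p) ^ 2) ≤
      (√(n : ℝ))⁻¹ * n := mul_le_mul_of_nonneg_left h2 (inv_nonneg.2 hs.le)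
  have h4 : (√(n : ℝ))⁻¹ * n = √n := by rw [inv_mul_eq_div, Real.div_sqrt]
  linarith

end Sampling

/-! ### Comparing the means of overlapping multisets. -/

theorem Multiset.exists_map_fst_map_snd {α γ : Type*} (s : Multiset α) (t : Multiset γ)
    (h : s.card = t.card) :
    ∃ p : Multiset (α × γ), p.map Prod.fst = s ∧ p.map Prod.snd = t := by
  induction s using Multiset.induction_on generalizing t with
  | empty => exact ⟨0, rfl, (Multiset.card_eq_zero.1 (by simpa using h.symm)).symm⟩
  | cons a s ih =>
    obtain ⟨b, hb⟩ : ∃ b, b ∈ t := Multiset.card_pos_iff_exists_mem.1 (by simp [← h])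
    obtain ⟨t, rfl⟩ := Multiset.exists_cons_of_mem hb
    obtain ⟨p, h1, h2⟩ := ih t (by simpa using h)
    exact ⟨(a, b) ::ₘ p, by simp [h1], by simp [h2]⟩

-- The common part is matched with itself at no cost; the rest is matched arbitrarily, at cost at
-- most `D` per pair.
open scoped Classical in
theorem IsMultisetMean.dist_le_card_sub {X : Type*} [MetricSpace X] {n : ℕ} {β : Multiset X → X}
    (h : IsMultisetMean n β) {s s' : Multiset X} (hs : s.card = n) (hs' : s'.card = n) {D : ℝ}
    (hD : ∀ a ∈ s, ∀ b ∈ s', dist a b ≤ D) :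
    n * dist (β s) (β s') ≤ D * (s - s').card := by
  have e1 : s - s' + s ∩ s' = s := Multiset.sub_add_inter s s'
  have e2 : s' - s + s ∩ s' = s' := by rw [Multiset.inter_comm]; exact Multiset.sub_add_inter s' s
  have hc : (s - s').card = (s' - s).card := by
    have h1 := congrArg Multiset.card e1
    have h2 := congrArg Multiset.card e2
    rw [Multiset.card_add] at h1 h2
    omega
  obtain ⟨p, h1, h2⟩ := Multiset.exists_map_fst_map_snd _ _ hc
  have hp : p.card = (s - s').card := by rw [← h1, Multiset.card_map]
  have f1 : (p + (s ∩ s').map fun a => (a, a)).map Prod.fst = s := by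
    rw [Multiset.map_add, h1, Multiset.map_map]; simpa using e1
  have f2 : (p + (s ∩ s').map fun a => (a, a)).map Prod.snd = s' := by
    rw [Multiset.map_add, h2, Multiset.map_map]; simpa using e2
  have h3 := h.lipschitz (p + (s ∩ s').map fun a => (a, a)) (by
    rw [← hs, ← f1, Multiset.card_map, f1])
  rw [f1, f2] at h3
  refine h3.trans ?_
  rw [Multiset.map_add, Multiset.sum_add, Multiset.map_map]
  simp only [Function.comp_def, dist_self, Multiset.map_const', Multiset.sum_replicate,
    smul_zero, add_zero]
  calc (p.map fun q => dist q.1 q.2).sum ≤ (p.map fun _ => D).sum := by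
        refine Multiset.sum_map_le_sum_map _ _ fun q hq => hD _ ?_ _ ?_
        · rw [← e1, h1.symm]
          exact Multiset.mem_add.2 (Or.inl (Multiset.mem_map_of_mem _ hq))
        · rw [← e2, h2.symm]
          exact Multiset.mem_add.2 (Or.inl (Multiset.mem_map_of_mem _ hq))
    _ = D * (s - s').card := by simp [hp, mul_comm]

open scoped Classical in
theorem Multiset.card_sub_le_sum_abs {α : Type*} {s s' : Multiset α} {t : Finset α}
    (hs : ∀ a ∈ s, a ∈ t) (c : α → ℝ) :
    ((s - s').card : ℝ) ≤ ∑ a ∈ t, (|(s.count a : ℝ) - c a| + |(s'.count a : ℝ) - c a|) := by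
  have h : ∀ a ∈ s - s', a ∈ t := fun a ha => hs a (Multiset.mem_of_le (Multiset.sub_le_self s s') ha)
  rw [← Multiset.sum_count_eq_card h, Nat.cast_sum]
  refine Finset.sum_le_sum fun a _ => ?_
  rw [Multiset.count_sub]
  have h1 := le_abs_self ((s.count a : ℝ) - c a)
  have h2 := neg_abs_le ((s'.count a : ℝ) - c a)
  rcases le_total (s.count a) (s'.count a) with h | h
  · rw [Nat.sub_eq_zero_of_le h, Nat.cast_zero]
    positivity
  · rw [Nat.cast_sub h]
    linarith

/-! ### Barycenters of simple functions by a law of large numbers. -/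

section Barycenter

variable {X : Type*} [MetricSpace X] {β : ℕ → Multiset X → X} {Ω : Type*} [MeasurableSpace Ω]
  (P : Measure Ω)

/-- `y` is the limit in `L¹` of the means of independent samples of `f`. -/
def IsSampleLimit (β : ℕ → Multiset X → X) (f : SimpleFunc Ω X) (y : X) : Prop :=
  Filter.Tendsto (fun n => sampleMean P f n fun s => dist (β n s) y) Filter.atTop (nhds 0)

variable [IsProbabilityMeasure P]

theorem IsMeanFamily.sampleMean_succ_le (h : IsMeanFamily β) (f : SimpleFunc Ω X) {n : ℕ}
    (hn : 0 < n) (z : X) :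
    sampleMean P f (n + 1) (fun s => dist (β (n + 1) s) z) ≤
      sampleMean P f n fun s => dist (β n s) z := by
  have h1 := sampleMean_mono P f (n + 1) (F := fun s => (n + 1 : ℝ) * dist (β (n + 1) s) z)
    (G := removalSum fun s => dist (β n s) z) fun s hs _ => (h.next n hn).2 s hs z
  rw [sampleMean_const_mul, sampleMean_removalSum] at h1
  exact le_of_mul_le_mul_left h1 (by positivity)

theorem IsMeanFamily.sampleMean_le (h : IsMeanFamily β) (f : SimpleFunc Ω X) {n m : ℕ}
    (hn : 0 < n) (hm : n ≤ m) (z : X) :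
    sampleMean P f m (fun s => dist (β m s) z) ≤ sampleMean P f n fun s => dist (β n s) z := by
  induction m, hm using Nat.le_induction with
  | base => exact le_rfl
  | succ m hm ih => exact (h.sampleMean_succ_le P f (hn.trans_le hm) z).trans ih

/-- Two samples differ in at most as many points as their counts deviate from the expected ones,
which is `O(√n)` on average; dividing by `n` gives the rate. -/
theorem IsMeanFamily.exists_spread_le (h : IsMeanFamily β) (f : SimpleFunc Ω X) :
    ∃ C : ℝ, 0 ≤ C ∧ ∀ n : ℕ, 0 < n → sampleMean P f n
      (fun s => sampleMean P f n fun s' => dist (β n s') (β n s)) ≤ C / √n := by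
  classical
  obtain ⟨D, hD0, hD⟩ := f.range.val.exists_dist_le
  refine ⟨D * (4 * f.range.card), by positivity, fun n hn => ?_⟩
  have hn0 : (0 : ℝ) < n := by exact_mod_cast hn
  set p : X → ℝ := fun a => n * ∫ ω, (if f ω = a then 1 else 0 : ℝ) ∂P with hp
  set H : Multiset X → ℝ := fun s => ∑ a ∈ f.range, |(s.count a : ℝ) - p a| with hH
  have hHle : sampleMean P f n H ≤ f.range.card * (2 * √n) := by
    rw [hH, sampleMean_sum, ← nsmul_eq_mul]
    exact Finset.sum_le_card_nsmul _ _ _ fun a _ => sampleMean_abs_count_le P f hn a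
  have hd : ∀ s s' : Multiset X, s.card = n → (∀ a ∈ s, a ∈ Set.range f) → s'.card = n →
      (∀ a ∈ s', a ∈ Set.range f) → dist (β n s') (β n s) ≤ D / n * H s' + D / n * H s := by
    intro s s' hs hsf hs' hsf'
    have h1 := (h.mean n hn).dist_le_card_sub hs' hs (D := D) fun a ha b hb =>
      hD a (SimpleFunc.mem_range.2 (hsf' a ha)) b (SimpleFunc.mem_range.2 (hsf b hb))
    have h2 := Multiset.card_sub_le_sum_abs (s := s') (s' := s) (t := f.range)
      (fun a ha => SimpleFunc.mem_range.2 (hsf' a ha)) p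
    rw [Finset.sum_add_distrib] at h2
    have h3 := h1.trans (mul_le_mul_of_nonneg_left h2 hD0)
    rw [← mul_add, div_mul_eq_mul_div, le_div_iff₀ hn0, mul_comm]
    exact h3
  have hm : sampleMean P f n (fun s => sampleMean P f n fun s' => dist (β n s') (β n s)) ≤
      sampleMean P f n fun s => D / n * sampleMean P f n H + D / n * H s := by
    refine sampleMean_mono P f n fun s hs hsf => ?_
    have := sampleMean_mono P f n fun s' hs' hsf' => hd s s' hs hsf hs' hsf'
    rwa [sampleMean_add, sampleMean_const_mul, sampleMean_const] at this
  rw [sampleMean_add, sampleMean_const, sampleMean_const_mul] at hm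
  have h4 : D / n * sampleMean P f n H ≤ D / n * (f.range.card * (2 * √n)) :=
    mul_le_mul_of_nonneg_left hHle (by positivity)
  have h5 : √(n : ℝ) / n = 1 / √n := Real.sqrt_div_self'
  calc _ ≤ D / n * (f.range.card * (2 * √n)) + D / n * (f.range.card * (2 * √n)) :=
        hm.trans (add_le_add h4 h4)
    _ = D * (4 * f.range.card) * (√n / n) := by ring
    _ = _ := by rw [h5]; ring

theorem IsMeanFamily.exists_isSampleLimit [CompleteSpace X] (h : IsMeanFamily β)
    (f : SimpleFunc Ω X) : ∃ y, IsSampleLimit P β f y := by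
  obtain ⟨C, hC0, hC⟩ := h.exists_spread_le P f
  have hex : ∀ k : ℕ, ∃ y, sampleMean P f (k + 1) (fun s => dist (β (k + 1) s) y) ≤
      C / √((k + 1 : ℕ) : ℝ) := by
    intro k
    -- The centre `y k` is the mean of one sample whose expected distance to the mean of an
    -- independent sample is at most average.
    obtain ⟨s, -, hs⟩ := exists_le_sampleMean P f (k + 1)
      fun s => sampleMean P f (k + 1) fun s' => dist (β (k + 1) s') (β (k + 1) s)
    exact ⟨_, hs.trans (hC _ k.succ_pos)⟩
  choose y hy using hex
  have hlim : Filter.Tendsto (fun k : ℕ => C / √((k + 1 : ℕ) : ℝ)) Filter.atTop (nhds 0) := by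
    refine Filter.Tendsto.div_atTop tendsto_const_nhds ?_
    exact Real.tendsto_sqrt_atTop.comp
      (tendsto_natCast_atTop_atTop.comp (Filter.tendsto_add_atTop_nat 1))
  have htri : ∀ k (u v : X), dist u v ≤ sampleMean P f k (fun s => dist (β k s) u) +
      sampleMean P f k (fun s => dist (β k s) v) := by
    intro k u v
    rw [← sampleMean_add, ← sampleMean_const P f k (dist u v)]
    exact sampleMean_mono P f k fun s _ _ => dist_triangle_left _ _ _
  have hdist : ∀ k l, k ≤ l → dist (y k) (y l) ≤ 2 * (C / √((k + 1 : ℕ) : ℝ)) := by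
    intro k l hkl
    have h1 := htri (l + 1) (y k) (y l)
    -- Monotonicity carries the bound around `y k` from sample size `k + 1` to `l + 1`, where it can
    -- be compared with the bound around `y l`.
    have h2 := h.sampleMean_le P f k.succ_pos (Nat.succ_le_succ hkl) (y k)
    have h3 : C / √((l + 1 : ℕ) : ℝ) ≤ C / √((k + 1 : ℕ) : ℝ) := by
      refine div_le_div_of_nonneg_left hC0 (Real.sqrt_pos.2 (by positivity)) ?_
      exact Real.sqrt_le_sqrt (by exact_mod_cast Nat.succ_le_succ hkl)
    linarith [hy k, hy l]
  have hcau : CauchySeq y := by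
    refine cauchySeq_of_le_tendsto_0' _ hdist ?_
    simpa using hlim.const_mul 2
  obtain ⟨z, hz⟩ := cauchySeq_tendsto_of_complete hcau
  refine ⟨z, (Filter.tendsto_add_atTop_iff_nat 1).1 ?_⟩
  have hz' : Filter.Tendsto (fun k => C / √((k + 1 : ℕ) : ℝ) + dist (y k) z) Filter.atTop
      (nhds 0) := by
    simpa using hlim.add (tendsto_iff_dist_tendsto_zero.1 hz)
  refine squeeze_zero (fun k => ?_) (fun k => ?_) hz'
  · rw [← sampleMean_const P f (k + 1) 0]
    exact sampleMean_mono P f _ fun s _ _ => dist_nonneg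
  · refine le_trans ?_ (add_le_add_left (hy k) _)
    rw [← sampleMean_const P f (k + 1) (dist (y k) z), ← sampleMean_add]
    exact sampleMean_mono P f _ fun s _ _ => dist_triangle _ _ _

/-- Sampling `f` and `g` jointly, the expected transport cost of `n` pairs is `n` times the
integral, and the means are 1-Lipschitz for it. -/
theorem IsMeanFamily.dist_isSampleLimit_le (h : IsMeanFamily β) {f g : SimpleFunc Ω X} {y z : X}
    (hy : IsSampleLimit P β f y) (hz : IsSampleLimit P β g z) :
    dist y z ≤ ∫ ω, dist (f ω) (g ω) ∂P := by
  have hlim : Filter.Tendsto (fun n => (sampleMean P f n fun s => dist (β n s) y) +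
      ((sampleMean P g n fun s => dist (β n s) z) + ∫ ω, dist (f ω) (g ω) ∂P)) Filter.atTop
      (nhds (0 + (0 + ∫ ω, dist (f ω) (g ω) ∂P))) :=
    Filter.Tendsto.add hy (Filter.Tendsto.add hz tendsto_const_nhds)
  rw [zero_add, zero_add] at hlim
  refine ge_of_tendsto hlim ?_
  filter_upwards [Filter.eventually_gt_atTop 0] with n hn
  have hn0 : (0 : ℝ) < n := by exact_mod_cast hn
  have e1 : f = (f.pair g).map Prod.fst := by ext; rfl
  have e2 : g = (f.pair g).map Prod.snd := by ext; rfl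
  have h1 : dist y z ≤ sampleMean P (f.pair g) n (fun p => dist (β n (p.map Prod.fst)) y +
      (dist (β n (p.map Prod.snd)) z + (n : ℝ)⁻¹ * (p.map fun q => dist q.1 q.2).sum)) := by
    rw [← sampleMean_const P (f.pair g) n (dist y z)]
    refine sampleMean_mono P _ n fun p hp _ => ?_
    have h2 := (h.mean n hn).lipschitz p hp
    have h3 : dist (β n (p.map Prod.fst)) (β n (p.map Prod.snd)) ≤
        (n : ℝ)⁻¹ * (p.map fun q => dist q.1 q.2).sum := by
      rw [← div_eq_inv_mul, le_div_iff₀ hn0, mul_comm]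
      exact h2
    have h4 := dist_triangle4 y (β n (p.map Prod.fst)) (β n (p.map Prod.snd)) z
    rw [dist_comm y (β n _)] at h4
    linarith
  rw [sampleMean_add, sampleMean_add, sampleMean_const_mul, sampleMean_sum_map,
    sampleMean_map P (f.pair g) Prod.fst n fun s => dist (β n s) y,
    sampleMean_map P (f.pair g) Prod.snd n fun s => dist (β n s) z, ← e1, ← e2,
    inv_mul_cancel_left₀ hn0.ne'] at h1
  exact h1

theorem IsMeanFamily.isSampleLimit_const (h : IsMeanFamily β) (x : X) :
    IsSampleLimit P β (SimpleFunc.const Ω x) x := by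
  refine tendsto_const_nhds.congr' ?_
  filter_upwards [Filter.eventually_gt_atTop 0] with n hn
  have h0 : ∀ s : Multiset X, s.card = n → (∀ a ∈ s, a ∈ Set.range (SimpleFunc.const Ω x)) →
      dist (β n s) x = 0 := by
    intro s hs hsf
    have : s = Multiset.replicate n x := Multiset.eq_replicate.2 ⟨hs, fun b hb => by
      obtain ⟨ω, hω⟩ := hsf b hb
      exact hω.symm⟩
    rw [this, (h.mean n hn).replicate, dist_self]
  rw [← sampleMean_const P (SimpleFunc.const Ω x) n 0]
  exact le_antisymm (sampleMean_mono P _ n fun s hs hsf => (h0 s hs hsf).ge)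
    (sampleMean_mono P _ n fun s hs hsf => (h0 s hs hsf).le)

omit [IsProbabilityMeasure P] in
theorem IsSampleLimit.comp {Ω' : Type*} [MeasurableSpace Ω'] {Q : Measure Ω'} {T : Ω' → Ω}
    (hT : Measurable T) (hQ : Q.map T = P) {f : SimpleFunc Ω X} {y : X}
    (hy : IsSampleLimit P β f y) : IsSampleLimit Q β (f.comp T hT) y := by
  unfold IsSampleLimit
  simp only [sampleMean_comp P f Q hT hQ]
  exact hy

theorem IsMeanFamily.edist_isSampleLimit_le (h : IsMeanFamily β) {f g : SimpleFunc Ω X} {y z : X}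
    (hy : IsSampleLimit P β f y) (hz : IsSampleLimit P β g z) :
    edist y z ≤ ∫⁻ ω, edist (f ω) (g ω) ∂P := by
  have hint : Integrable (fun ω => dist (f ω) (g ω)) P :=
    SimpleFunc.integrable_comp P (f.pair g) fun q => dist q.1 q.2
  have h1 := h.dist_isSampleLimit_le P hy hz
  rw [edist_dist]
  refine (ENNReal.ofReal_le_ofReal h1).trans ?_
  rw [ofReal_integral_eq_lintegral_ofReal hint (Filter.Eventually.of_forall fun _ => dist_nonneg)]
  simp only [← edist_dist, le_refl]

end Barycenter

/-! ### Extension to Wasserstein space by density of simple push-forwards. -/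

section Extension

variable {X : Type*} [MetricSpace X] {β : ℕ → Multiset X → X} [MeasurableSpace X] [BorelSpace X]

/-- `y` extends the barycenter of simple push-forwards of `μ` in a `1`-Lipschitz way to `μ`. -/
def IsBarycenter (β : ℕ → Multiset X → X) (μ : Measure X) (y : X) : Prop :=
  ∀ (φ : SimpleFunc X X) (z : X), IsSampleLimit μ β φ z → edist z y ≤ ∫⁻ x, edist (φ x) x ∂μ

/-- `μ` is a limit of simple push-forwards in the Wasserstein `1`-distance. -/
def IsSimplyApproximable (μ : Measure X) : Prop :=
  ∀ ε : ℝ≥0∞, ε ≠ 0 → ∃ φ : SimpleFunc X X, ∫⁻ x, edist (φ x) x ∂μ ≤ ε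

theorem SimpleFunc.measurable_edist_self (φ : SimpleFunc X X) :
    Measurable fun x => edist (φ x) x :=
  φ.measurable_bind (fun a x => edist a x) fun _ =>
    (continuous_const.edist continuous_id).measurable

theorem IsMeanFamily.exists_isBarycenter [CompleteSpace X] (h : IsMeanFamily β) {μ : Measure X}
    [IsProbabilityMeasure μ] (hμ : IsSimplyApproximable μ) : ∃ y, IsBarycenter β μ y := by
  have hex : ∀ n : ℕ, ∃ φ : SimpleFunc X X, ∃ z, IsSampleLimit μ β φ z ∧
      ∫⁻ x, edist (φ x) x ∂μ ≤ (n : ℝ≥0∞)⁻¹ := by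
    intro n
    obtain ⟨φ, hφ⟩ := hμ (n : ℝ≥0∞)⁻¹ (by simp)
    obtain ⟨z, hz⟩ := h.exists_isSampleLimit μ φ
    exact ⟨φ, z, hz, hφ⟩
  choose φ z hz hφ using hex
  have hclose : ∀ (ψ : SimpleFunc X X) (w : X), IsSampleLimit μ β ψ w → ∀ n,
      edist w (z n) ≤ ∫⁻ x, edist (ψ x) x ∂μ + (n : ℝ≥0∞)⁻¹ := by
    intro ψ w hw n
    calc edist w (z n) ≤ ∫⁻ x, edist (ψ x) (φ n x) ∂μ := h.edist_isSampleLimit_le μ hw (hz n)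
      _ ≤ ∫⁻ x, edist (ψ x) x + edist (φ n x) x ∂μ :=
          lintegral_mono fun x => edist_triangle_right _ _ _
      _ = ∫⁻ x, edist (ψ x) x ∂μ + ∫⁻ x, edist (φ n x) x ∂μ :=
          lintegral_add_right _ (SimpleFunc.measurable_edist_self _)
      _ ≤ _ := add_le_add le_rfl (hφ n)
  have hcau : CauchySeq z := by
    refine EMetric.cauchySeq_iff_le_tendsto_0.2
      ⟨fun N => (N : ℝ≥0∞)⁻¹ + (N : ℝ≥0∞)⁻¹, fun n m N hn hm => ?_, ?_⟩
    · refine (hclose _ _ (hz n) m).trans (add_le_add ((hφ n).trans ?_) ?_) <;>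
      exact ENNReal.inv_le_inv.2 (by exact_mod_cast ‹_›)
    · simpa using ENNReal.tendsto_inv_nat_nhds_zero.add ENNReal.tendsto_inv_nat_nhds_zero
  obtain ⟨y, hy⟩ := cauchySeq_tendsto_of_complete hcau
  refine ⟨y, fun ψ w hw => ?_⟩
  have h1 : Filter.Tendsto (fun n => edist w (z n)) Filter.atTop (nhds (edist w y)) :=
    tendsto_const_nhds.edist hy
  have h2 : Filter.Tendsto (fun n : ℕ => ∫⁻ x, edist (ψ x) x ∂μ + (n : ℝ≥0∞)⁻¹) Filter.atTop
      (nhds (∫⁻ x, edist (ψ x) x ∂μ + 0)) :=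
    tendsto_const_nhds.add ENNReal.tendsto_inv_nat_nhds_zero
  rw [add_zero] at h2
  exact le_of_tendsto_of_tendsto' h1 h2 (hclose ψ w hw)

theorem IsMeanFamily.edist_isBarycenter_le [CompleteSpace X] (h : IsMeanFamily β)
    {μ ν : Measure X} [IsProbabilityMeasure μ] [IsProbabilityMeasure ν]
    (hμ : IsSimplyApproximable μ) (hν : IsSimplyApproximable ν) {y y' : X}
    (hy : IsBarycenter β μ y) (hy' : IsBarycenter β ν y')
    {Ω : Type*} [MeasurableSpace Ω] {Q : Measure Ω} [IsProbabilityMeasure Q] {T S : Ω → X}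
    (hT : Measurable T) (hS : Measurable S) (hQT : Q.map T = μ) (hQS : Q.map S = ν) :
    edist y y' ≤ ∫⁻ ω, edist (T ω) (S ω) ∂Q := by
  set I := ∫⁻ ω, edist (T ω) (S ω) ∂Q
  have key : ∀ n : ℕ, edist y y' ≤ I + 4 * (n : ℝ≥0∞)⁻¹ := by
    intro n
    obtain ⟨φ, hφ⟩ := hμ (n : ℝ≥0∞)⁻¹ (by simp)
    obtain ⟨ψ, hψ⟩ := hν (n : ℝ≥0∞)⁻¹ (by simp)
    obtain ⟨z, hz⟩ := h.exists_isSampleLimit μ φ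
    obtain ⟨z', hz'⟩ := h.exists_isSampleLimit ν ψ
    have mφ := SimpleFunc.measurable_edist_self φ
    have mψ := SimpleFunc.measurable_edist_self ψ
    have mψS : Measurable fun ω => edist (ψ (S ω)) (S ω) := mψ.comp hS
    have mφT : Measurable fun ω => edist (φ (T ω)) (T ω) := mφ.comp hT
    have hzz : edist z z' ≤ (n : ℝ≥0∞)⁻¹ + I + (n : ℝ≥0∞)⁻¹ :=
      calc edist z z' ≤ ∫⁻ ω, edist (φ (T ω)) (ψ (S ω)) ∂Q :=
            h.edist_isSampleLimit_le Q (hz.comp μ hT hQT) (hz'.comp ν hS hQS)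
        _ ≤ ∫⁻ ω, (edist (φ (T ω)) (T ω) + edist (T ω) (S ω)) + edist (ψ (S ω)) (S ω) ∂Q :=
            lintegral_mono fun ω => by
              rw [edist_comm (ψ (S ω))]
              exact edist_triangle4 _ _ _ _
        _ = ∫⁻ x, edist (φ x) x ∂μ + I + ∫⁻ x, edist (ψ x) x ∂ν := by
            -- The outer terms are split off so that measurability of `edist (T ω) (S ω)` is never
            -- needed; `X` need not be second countable.
            rw [lintegral_add_right _ mψS, lintegral_add_left mφT, ← hQT,
              ← hQS, lintegral_map mφ hT, lintegral_map mψ hS]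
        _ ≤ _ := add_le_add (add_le_add hφ le_rfl) hψ
    calc edist y y' ≤ edist y z + edist z z' + edist z' y' := edist_triangle4 _ _ _ _
      _ ≤ (n : ℝ≥0∞)⁻¹ + ((n : ℝ≥0∞)⁻¹ + I + (n : ℝ≥0∞)⁻¹) + (n : ℝ≥0∞)⁻¹ := by
          refine add_le_add (add_le_add ?_ hzz) ((hy' ψ z' hz').trans hψ)
          rw [edist_comm]
          exact (hy φ z hz).trans hφ
      _ = _ := by ring
  have hlim : Filter.Tendsto (fun n : ℕ => I + 4 * (n : ℝ≥0∞)⁻¹) Filter.atTop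
      (nhds (I + 4 * 0)) :=
    tendsto_const_nhds.add
      (ENNReal.Tendsto.const_mul ENNReal.tendsto_inv_nat_nhds_zero (Or.inr (by simp)))
  simpa using ge_of_tendsto' hlim key

theorem IsMeanFamily.eq_of_isBarycenter_dirac (h : IsMeanFamily β) {x y : X}
    (hy : IsBarycenter β (Measure.dirac x) y) : y = x := by
  have h1 := hy (SimpleFunc.const X x) x (h.isSampleLimit_const _ x)
  rw [lintegral_dirac' _ (SimpleFunc.measurable_edist_self _)] at h1
  simpa [eq_comm] using h1

/-- Simple approximations of the identity with values in `insert x₀ S` converge on `S`, and their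
errors are dominated by the integrable distance to `x₀`. -/
theorem isSimplyApproximable_of_isSeparable {μ : Measure X} {S : Set X}
    (hS : TopologicalSpace.IsSeparable S) (hμS : μ Sᶜ = 0) {x₀ : X}
    (hx₀ : ∫⁻ x, edist x₀ x ∂μ ≠ ∞) : IsSimplyApproximable μ := by
  intro ε hε
  have hsep : TopologicalSpace.IsSeparable (insert x₀ S) := by
    rw [Set.insert_eq]
    exact (Set.countable_singleton x₀).isSeparable.union hS
  have := hsep.separableSpace
  have h0 : x₀ ∈ insert x₀ S := Set.mem_insert _ _
  have hid : Measurable (id : X → X) := measurable_id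
  have hlim : Filter.Tendsto
      (fun n => ∫⁻ x, edist (SimpleFunc.approxOn id hid (insert x₀ S) x₀ h0 n x) x ∂μ)
      Filter.atTop (nhds (∫⁻ _, 0 ∂μ)) := by
    refine tendsto_lintegral_of_dominated_convergence (fun x => edist x₀ x)
      (fun n => SimpleFunc.measurable_edist_self _)
      (fun n => Filter.Eventually.of_forall fun x => SimpleFunc.edist_approxOn_le hid h0 x n)
      hx₀ ?_
    have hae : ∀ᵐ x ∂μ, x ∈ S := by rw [ae_iff]; exact hμS
    filter_upwards [hae] with x hx
    have h1 := SimpleFunc.tendsto_approxOn hid h0 (x := x)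
      (subset_closure (Set.mem_insert_of_mem _ hx))
    simpa using h1.edist (tendsto_const_nhds (x := x))
  rw [lintegral_zero] at hlim
  obtain ⟨n, hn⟩ := (hlim.eventually (gt_mem_nhds (pos_iff_ne_zero.2 hε))).exists
  exact ⟨_, hn.le⟩

end Extension

theorem Wasserstein1.isSimplyApproximable {X : Type*} [MetricSpace X] (μ : Wasserstein1 X) :
    letI : MeasurableSpace X := borel X
    haveI : BorelSpace X := ⟨rfl⟩
    IsSimplyApproximable μ.1.meas := by
  let : MeasurableSpace X := borel X
  have : BorelSpace X := ⟨rfl⟩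
  let : MeasurableSpace (X × X) := borel (X × X)
  have : BorelSpace (X × X) := ⟨rfl⟩
  obtain ⟨x₀, hx₀⟩ := μ.2
  obtain ⟨S, hS, hμS⟩ := μ.1.sep
  have h1 : Measurable (Prod.fst : X × X → X) := continuous_fst.measurable
  have h2 : Measurable (Prod.snd : X × X → X) := continuous_snd.measurable
  simp only [wassersteinDist, iInf_lt_iff] at hx₀
  obtain ⟨K, hK, hlt⟩ := hx₀
  refine isSimplyApproximable_of_isSeparable hS hμS (x₀ := x₀) (ne_of_lt ?_)
  refine lt_of_eq_of_lt ?_ hlt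
  have hm : Measurable fun x : X => edist x₀ x := (continuous_const.edist continuous_id).measurable
  rw [← hK.2, lintegral_map hm h2]
  refine lintegral_congr_ae ?_
  -- The first coordinate of a coupling with `δ_{x₀}` is almost surely `x₀`, so its cost is the
  -- first moment of `μ` about `x₀`.
  have hae : ∀ᵐ x ∂(Measure.map Prod.fst K.meas), x = x₀ := by
    rw [hK.1]
    change ∀ᵐ x ∂(Measure.dirac x₀), x = x₀
    exact (ae_dirac_iff (p := fun x => x = x₀) (measurableSet_singleton x₀)).2 rfl
  filter_upwards [ae_of_ae_map h1.aemeasurable hae] with p hp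
  rw [hp]

theorem IsMeanFamily.exists_contractingBarycenterMap {X : Type*} [MetricSpace X] [CompleteSpace X]
    {β : ℕ → Multiset X → X} (h : IsMeanFamily β) :
    ∃ b : Wasserstein1 X → X, IsContractingBarycenterMap b := by
  let : MeasurableSpace X := borel X
  have : BorelSpace X := ⟨rfl⟩
  have hex : ∀ μ : Wasserstein1 X, ∃ y, IsBarycenter β μ.1.meas y := fun μ =>
    have := μ.1.prob
    h.exists_isBarycenter μ.isSimplyApproximable
  choose b hb using hex
  refine ⟨b, fun x => h.eq_of_isBarycenter_dirac (hb (Wasserstein1.dirac x)), fun μ ν => ?_⟩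
  refine le_iInf₂ fun K hK => ?_
  let : MeasurableSpace (X × X) := borel (X × X)
  have : BorelSpace (X × X) := ⟨rfl⟩
  have := μ.1.prob
  have := ν.1.prob
  have := K.prob
  exact h.edist_isBarycenter_le μ.isSimplyApproximable ν.isSimplyApproximable (hb μ) (hb ν)
    continuous_fst.measurable continuous_snd.measurable hK.1 hK.2

theorem IsConicalBicombing.isMidpointMap {X : Type*} [MetricSpace X]
    {σ : X → X → unitInterval → X} (h : IsConicalBicombing σ) :
    IsMidpointMap fun x y => σ x y ⟨1 / 2, by norm_num, by norm_num⟩ where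
  self x := by
    have := h.geodesic x x ⟨1 / 2, by norm_num, by norm_num⟩ 0
    rw [h.map_zero, dist_self, mul_zero] at this
    exact dist_eq_zero.1 this
  conical x y x' y' := by
    have := h.conical x y x' y' ⟨1 / 2, by norm_num, by norm_num⟩
    dsimp only at this ⊢
    linarith

/-! ### From barycenter maps to conical bicombings. -/

section MixCouplings

variable {X : Type*} [MetricSpace X]

theorem wassersteinDist_mix_mix_le (x y x' y' : X) (t : unitInterval) :
    wassersteinDist (SepProb.mix x y t) (SepProb.mix x' y' t) ≤
      ENNReal.ofReal ((1 - (t : ℝ)) * dist x x' + (t : ℝ) * dist y y') := by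
  let : MeasurableSpace X := borel X
  have : BorelSpace X := ⟨rfl⟩
  let : MeasurableSpace (X × X) := borel (X × X)
  have : BorelSpace (X × X) := ⟨rfl⟩
  have h1 : Measurable (Prod.fst : X × X → X) := continuous_fst.measurable
  have h2 : Measurable (Prod.snd : X × X → X) := continuous_snd.measurable
  have hd : Measurable fun p : X × X => edist p.1 p.2 := continuous_edist.measurable
  have ht0 := t.2.1
  have ht1 := sub_nonneg.2 t.2.2
  have hK : IsCoupling (SepProb.mix x y t) (SepProb.mix x' y' t)
      (SepProb.mix (x, x') (y, y') t) := by
    constructor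
    · change Measure.map Prod.fst (_ • Measure.dirac (x, x') + _ • Measure.dirac (y, y')) =
        _ • Measure.dirac x + _ • Measure.dirac y
      rw [Measure.map_add _ _ h1, Measure.map_smul, Measure.map_smul, Measure.map_dirac' h1,
        Measure.map_dirac' h1]
    · change Measure.map Prod.snd (_ • Measure.dirac (x, x') + _ • Measure.dirac (y, y')) =
        _ • Measure.dirac x' + _ • Measure.dirac y'
      rw [Measure.map_add _ _ h2, Measure.map_smul, Measure.map_smul, Measure.map_dirac' h2,
        Measure.map_dirac' h2]
  refine (iInf₂_le _ hK).trans (le_of_eq ?_)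
  change ∫⁻ p : X × X, edist p.1 p.2 ∂(ENNReal.ofReal (1 - (t : ℝ)) • Measure.dirac (x, x') +
    ENNReal.ofReal (t : ℝ) • Measure.dirac (y, y')) = _
  rw [lintegral_add_measure, lintegral_smul_measure, lintegral_smul_measure,
    lintegral_dirac' _ hd, lintegral_dirac' _ hd, edist_dist, edist_dist, smul_eq_mul,
    smul_eq_mul, ← ENNReal.ofReal_mul ht1, ← ENNReal.ofReal_mul ht0,
    ← ENNReal.ofReal_add (by positivity) (by positivity)]

/-- The coupling of `mix x y s` and `mix x y t` for `s ≤ t` that moves mass `t - s` from `x` to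
`y`. -/
noncomputable def SepProb.mixCoupling (x y : X) (s t : unitInterval) (hst : s ≤ t) :
    SepProb (X × X) where
  meas := ENNReal.ofReal (1 - (t : ℝ)) • borelDirac (x, x) +
    (ENNReal.ofReal ((t : ℝ) - s) • borelDirac (x, y) + ENNReal.ofReal (s : ℝ) • borelDirac (y, y))
  prob := by
    let : MeasurableSpace (X × X) := borel (X × X)
    refine ⟨?_⟩
    have hst' : (s : ℝ) ≤ t := hst
    simp only [borelDirac, Measure.add_apply, Measure.smul_apply, Measure.dirac_apply_of_mem,
      Set.mem_univ, smul_eq_mul, mul_one]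
    rw [← ENNReal.ofReal_add (sub_nonneg.2 hst') s.2.1,
      ← ENNReal.ofReal_add (sub_nonneg.2 t.2.2) (by simpa using t.2.1)]
    simp
  sep := by
    let : MeasurableSpace (X × X) := borel (X × X)
    have : BorelSpace (X × X) := ⟨rfl⟩
    have hm : MeasurableSet ({(x, x), (x, y), (y, y)} : Set (X × X))ᶜ :=
      (Set.toFinite _).isClosed.measurableSet.compl
    refine ⟨{(x, x), (x, y), (y, y)}, (Set.toFinite _).countable.isSeparable, ?_⟩
    simp [borelDirac, Measure.dirac_apply' _ hm]

theorem SepProb.isCoupling_mixCoupling (x y : X) (s t : unitInterval) (hst : s ≤ t) :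
    IsCoupling (SepProb.mix x y s) (SepProb.mix x y t) (SepProb.mixCoupling x y s t hst) := by
  let : MeasurableSpace X := borel X
  have : BorelSpace X := ⟨rfl⟩
  let : MeasurableSpace (X × X) := borel (X × X)
  have : BorelSpace (X × X) := ⟨rfl⟩
  have h1 : Measurable (Prod.fst : X × X → X) := continuous_fst.measurable
  have h2 : Measurable (Prod.snd : X × X → X) := continuous_snd.measurable
  have hst' : (s : ℝ) ≤ t := hst
  have ht1 := sub_nonneg.2 t.2.2
  constructor
  · change Measure.map Prod.fst (_ • Measure.dirac (x, x) +
      (_ • Measure.dirac (x, y) + _ • Measure.dirac (y, y))) =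
        _ • Measure.dirac x + _ • Measure.dirac y
    rw [Measure.map_add _ _ h1, Measure.map_add _ _ h1, Measure.map_smul, Measure.map_smul,
      Measure.map_smul, Measure.map_dirac' h1, Measure.map_dirac' h1, Measure.map_dirac' h1,
      ← add_assoc, ← add_smul, ← ENNReal.ofReal_add ht1 (sub_nonneg.2 hst'), sub_add_sub_cancel]
  · change Measure.map Prod.snd (_ • Measure.dirac (x, x) +
      (_ • Measure.dirac (x, y) + _ • Measure.dirac (y, y))) =
        _ • Measure.dirac x + _ • Measure.dirac y
    rw [Measure.map_add _ _ h2, Measure.map_add _ _ h2, Measure.map_smul, Measure.map_smul,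
      Measure.map_smul, Measure.map_dirac' h2, Measure.map_dirac' h2, Measure.map_dirac' h2,
      ← add_smul, ← ENNReal.ofReal_add (sub_nonneg.2 hst') s.2.1, sub_add_cancel]

theorem wassersteinDist_mix_le (x y : X) (s t : unitInterval) (hst : s ≤ t) :
    wassersteinDist (SepProb.mix x y s) (SepProb.mix x y t) ≤
      ENNReal.ofReal (((t : ℝ) - s) * dist x y) := by
  let : MeasurableSpace (X × X) := borel (X × X)
  have : BorelSpace (X × X) := ⟨rfl⟩
  have hd : Measurable fun p : X × X => edist p.1 p.2 := continuous_edist.measurable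
  refine (iInf₂_le _ (SepProb.isCoupling_mixCoupling x y s t hst)).trans (le_of_eq ?_)
  change ∫⁻ p : X × X, edist p.1 p.2 ∂(ENNReal.ofReal (1 - (t : ℝ)) • Measure.dirac (x, x) +
    (ENNReal.ofReal ((t : ℝ) - s) • Measure.dirac (x, y) +
      ENNReal.ofReal (s : ℝ) • Measure.dirac (y, y))) = _
  rw [lintegral_add_measure, lintegral_add_measure, lintegral_smul_measure, lintegral_smul_measure,
    lintegral_smul_measure, lintegral_dirac' _ hd, lintegral_dirac' _ hd, lintegral_dirac' _ hd,
    ENNReal.ofReal_mul (sub_nonneg.2 hst), ← edist_dist]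
  simp

theorem SepProb.mix_one (x y : X) : SepProb.mix x y 1 = SepProb.dirac y := by
  simp [SepProb.mix, SepProb.dirac]

theorem IsContractingBarycenterMap.isConicalBicombing {b : Wasserstein1 X → X}
    (hb : IsContractingBarycenterMap b) :
    IsConicalBicombing fun x y t => b (Wasserstein1.mix x y t) := by
  have h0 : ∀ x y, b (Wasserstein1.mix x y 0) = x := fun x y => by
    rw [show Wasserstein1.mix x y 0 = Wasserstein1.dirac x from
      Subtype.ext (SepProb.mix_zero x y), hb.map_dirac]
  have h1 : ∀ x y, b (Wasserstein1.mix x y 1) = y := fun x y => by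
    rw [show Wasserstein1.mix x y 1 = Wasserstein1.dirac y from
      Subtype.ext (SepProb.mix_one x y), hb.map_dirac]
  have hle : ∀ x y (s t : unitInterval), s ≤ t →
      dist (b (Wasserstein1.mix x y s)) (b (Wasserstein1.mix x y t)) ≤ ((t : ℝ) - s) * dist x y := by
    intro x y s t hst
    have := (hb.contracting (Wasserstein1.mix x y s) (Wasserstein1.mix x y t)).trans
      (wassersteinDist_mix_le x y s t hst)
    rw [edist_dist] at this
    exact (ENNReal.ofReal_le_ofReal_iff (mul_nonneg (sub_nonneg.2 hst) dist_nonneg)).1 this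
  have heq : ∀ x y (s t : unitInterval), s ≤ t →
      dist (b (Wasserstein1.mix x y s)) (b (Wasserstein1.mix x y t)) = ((t : ℝ) - s) * dist x y := by
    intro x y s t hst
    refine le_antisymm (hle x y s t hst) ?_
    -- The upper bounds on `[0, s]`, `[s, t]` and `[t, 1]` add up to `dist x y`, so none of them can
    -- be strict.
    have a1 := hle x y 0 s s.2.1
    have a2 := hle x y t 1 t.2.2
    have a3 := dist_triangle4 x (b (Wasserstein1.mix x y s)) (b (Wasserstein1.mix x y t)) y
    rw [h0] at a1
    rw [h1] at a2
    push_cast at a1 a2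
    linarith
  refine ⟨h0, h1, fun x y s t => ?_, fun x y x' y' t => ?_⟩
  · rcases le_total s t with hst | hst
    · rw [heq x y s t hst, abs_sub_comm, abs_of_nonneg (sub_nonneg.2 (show (s : ℝ) ≤ t from hst))]
    · rw [dist_comm, heq x y t s hst, abs_of_nonneg (sub_nonneg.2 (show (t : ℝ) ≤ s from hst))]
  · have h := (hb.contracting (Wasserstein1.mix x y t) (Wasserstein1.mix x' y' t)).trans
      (wassersteinDist_mix_mix_le x y x' y' t)
    rw [edist_dist] at h
    have ht0 := t.2.1
    have ht1 := sub_nonneg.2 t.2.2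
    exact (ENNReal.ofReal_le_ofReal_iff (by positivity)).1 h

end MixCouplings

theorem Wasserstein1.nonempty_of {X : Type*} [MetricSpace X] (μ : Wasserstein1 X) : Nonempty X :=
  ⟨μ.2.choose⟩

theorem theorem2p4 {X : Type*} [MetricSpace X] :
    (∀ b : Wasserstein1 X → X, IsContractingBarycenterMap b →
      IsConicalBicombing (fun x y t => b (Wasserstein1.mix x y t))) ∧
    (CompleteSpace X → (∃ σ : X → X → unitInterval → X, IsConicalBicombing σ) →
      ∃ b : Wasserstein1 X → X, IsContractingBarycenterMap b) := by
  refine ⟨fun b hb => hb.isConicalBicombing, ?_⟩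
  rintro _ ⟨σ, hσ⟩
  rcases isEmpty_or_nonempty X with hX | hX
  -- For empty `X` the space `𝒫₁(X)` is empty too, so there is nothing to check.
  · exact ⟨fun μ => μ.nonempty_of.some, fun x => hX.elim x, fun μ => hX.elim μ.nonempty_of.some⟩
  · obtain ⟨β, hβ⟩ := hσ.isMidpointMap.exists_meanFamily
    exact hβ.exists_contractingBarycenterMap
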